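/- Let $(M,g)$ be a spacetime, i.e. a smooth four-dimensional manifold with a smooth Lorentzian metric $g$ of signature $(-,+,+,+)$, let $\nabla$ be its Levi-Civita connection and $R_{\alpha\beta\lambda\mu}$ its Riemann tensor, and let $$B_{\alpha\beta\lambda\mu}=R_{\alpha\rho\lambda\sigma}R_{\beta}{}^{\rho}{}_{\mu}{}^{\sigma}+R_{\alpha\rho\mu\sigma}R_{\beta}{}^{\rho}{}_{\lambda}{}^{\sigma}-\tfrac12 g_{\alpha\beta}R_{\rho\tau\lambda\sigma}R^{\rho\tau}{}_{\mu}{}^{\sigma}-\tfrac12 g_{\lambda\mu}R_{\alpha\rho\sigma\tau}R_{\beta}{}^{\rho\sigma\tau}+\tfrac18 g_{\alpha\beta}g_{\lambda\mu}R_{\rho\tau\sigma\nu}R^{\rho\tau\sigma\nu}$$ be the Bel tensor. For vector fields $\vec\xi_1,\vec\xi_2,\vec\xi_3$ the Bel current is the 1-form $j_\mu(\vec\xi_1,\vec\xi_2,\vec\xi_3)=B_{(\alpha\beta\lambda)\mu}\xi_1^\alpha\xi_2^\beta\xi_3^\lambda$, and $j(\vec\xi)=j(\vec\xi,\vec\xi,\vec\xi)$.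 Let $\vec\xi$ be a smooth Killing vector field of $(M,g)$, i.e. $\nabla_\alpha\xi_\beta+\nabla_\beta\xi_\alpha=0$, which is hypersurface-orthogonal, i.e. $\boldsymbol\xi\wedge d\boldsymbol\xi=0$ for the 1-form $\boldsymbol\xi=\xi_\mu dx^\mu$, $\xi_\mu=g_{\mu\nu}\xi^\nu$. Then $$ j(\vec\xi)\wedge\boldsymbol\xi=0 $$ everywhere on $M$. In other words, the current is parallel to $\vec\xi$: at every point of $M$ there is a real number $a$ with $j^\mu(\vec\xi)=a\,\xi^\mu$. -/

import Mathlib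

open scoped Manifold ContDiff

noncomputable section

namespace Spacetime

/-- The coordinate space `ℝ⁴`, on which spacetimes are modelled. -/
abbrev R4 : Type := EuclideanSpace ℝ (Fin 4)

/-! ### Tensor calculus in a coordinate system

In this section `g` is the matrix `g_{ij}` of a metric and `ξ`, `v` are the contravariant components
of vector fields, as functions of the coordinates `y ∈ ℝ⁴`. Lower and upper indices are written in
the order in which they occur in the usual index notation. -/

namespace Coord

/-- The partial derivative `∂_i f` at the point with coordinates `y`. -/
def pd (i : Fin 4) (f : R4 → ℝ) (y : R4) : ℝ :=
  fderiv ℝ f y (EuclideanSpace.single i (1 : ℝ))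

/-- The inverse metric `g^{ij}`. -/
def ginv (g : R4 → Matrix (Fin 4) (Fin 4) ℝ) (y : R4) : Matrix (Fin 4) (Fin 4) ℝ :=
  (g y)⁻¹

/-- The 1-form `v_i = g_{ij} v^j` obtained by lowering the index of a vector field. -/
def lower (g : R4 → Matrix (Fin 4) (Fin 4) ℝ) (v : R4 → Fin 4 → ℝ) (y : R4) (i : Fin 4) : ℝ :=
  ∑ j, g y i j * v y j

/-- The vector field `w^i = g^{ij} w_j` obtained by raising the index of a 1-form. -/
def raise (g : R4 → Matrix (Fin 4) (Fin 4) ℝ) (w : R4 → Fin 4 → ℝ) (y : R4) (i : Fin 4) : ℝ :=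
  ∑ j, ginv g y i j * w y j

/-- The Christoffel symbols of the Levi-Civita connection,
`Γ^k_{ij} = ½ g^{kl} (∂_i g_{jl} + ∂_j g_{il} - ∂_l g_{ij})`. -/
def christoffel (g : R4 → Matrix (Fin 4) (Fin 4) ℝ) (k i j : Fin 4) (y : R4) : ℝ :=
  1 / 2 * ∑ l, ginv g y k l *
    (pd i (fun z => g z j l) y + pd j (fun z => g z i l) y - pd l (fun z => g z i j) y)

/-- The curvature tensor
`R^ρ_{σμν} = ∂_μ Γ^ρ_{νσ} - ∂_ν Γ^ρ_{μσ} + Γ^ρ_{μλ} Γ^λ_{νσ} - Γ^ρ_{νλ} Γ^λ_{μσ}`. -/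
def riemannUp (g : R4 → Matrix (Fin 4) (Fin 4) ℝ) (y : R4) (ρ σ μ ν : Fin 4) : ℝ :=
  pd μ (christoffel g ρ ν σ) y - pd ν (christoffel g ρ μ σ) y
    + ∑ l, christoffel g ρ μ l y * christoffel g l ν σ y
    - ∑ l, christoffel g ρ ν l y * christoffel g l μ σ y

/-- The Riemann tensor with all indices down, `R_{αβμν} = g_{αρ} R^ρ_{βμν}`. -/
def riemann (g : R4 → Matrix (Fin 4) (Fin 4) ℝ) (y : R4) (α β μ ν : Fin 4) : ℝ :=
  ∑ ρ, g y α ρ * riemannUp g y ρ β μ ν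

/-- The Bel tensor
`B_{αβλμ} = R_{αρλσ} R_β^ρ_μ^σ + R_{αρμσ} R_β^ρ_λ^σ - ½ g_{αβ} R_{ρτλσ} R^{ρτ}_μ^σ
  - ½ g_{λμ} R_{αρστ} R_β^{ρστ} + ⅛ g_{αβ} g_{λμ} R_{ρτσν} R^{ρτσν}`.
All raised indices are written out: a primed summation index is the lower index into which the
corresponding unprimed one is turned by the inverse metric. -/
def bel (g : R4 → Matrix (Fin 4) (Fin 4) ℝ) (y : R4) (α β l μ : Fin 4) : ℝ :=
  let R := riemann g y
  let h := ginv g y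
  (∑ ρ, ∑ ρ', ∑ σ, ∑ σ', h ρ ρ' * h σ σ' * (R α ρ l σ * R β ρ' μ σ'))
    + (∑ ρ, ∑ ρ', ∑ σ, ∑ σ', h ρ ρ' * h σ σ' * (R α ρ μ σ * R β ρ' l σ'))
    - 1 / 2 * g y α β * (∑ ρ, ∑ ρ', ∑ τ, ∑ τ', ∑ σ, ∑ σ',
        h ρ ρ' * h τ τ' * h σ σ' * (R ρ τ l σ * R ρ' τ' μ σ'))
    - 1 / 2 * g y l μ * (∑ ρ, ∑ ρ', ∑ σ, ∑ σ', ∑ τ, ∑ τ',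
        h ρ ρ' * h σ σ' * h τ τ' * (R α ρ σ τ * R β ρ' σ' τ'))
    + 1 / 8 * g y α β * g y l μ * (∑ ρ, ∑ ρ', ∑ τ, ∑ τ', ∑ σ, ∑ σ', ∑ ν, ∑ ν',
        h ρ ρ' * h τ τ' * h σ σ' * h ν ν' * (R ρ τ σ ν * R ρ' τ' σ' ν'))

/-- The symmetrization `B_{(αβλ)μ}` of the Bel tensor over its first three indices. -/
def belSymm (g : R4 → Matrix (Fin 4) (Fin 4) ℝ) (y : R4) (α β l μ : Fin 4) : ℝ :=
  1 / 6 * (bel g y α β l μ + bel g y β l α μ + bel g y l α β μ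
    + bel g y β α l μ + bel g y α l β μ + bel g y l β α μ)

/-- The Bel current `j_μ(ξ₁, ξ₂, ξ₃) = B_{(αβλ)μ} ξ₁^α ξ₂^β ξ₃^λ` of three vector fields. -/
def current (g : R4 → Matrix (Fin 4) (Fin 4) ℝ) (ξ₁ ξ₂ ξ₃ : R4 → Fin 4 → ℝ) (y : R4)
    (μ : Fin 4) : ℝ :=
  ∑ α, ∑ β, ∑ l, belSymm g y α β l μ * ξ₁ y α * ξ₂ y β * ξ₃ y l

/-- The covariant derivative `∇_α w_β = ∂_α w_β - Γ^λ_{αβ} w_λ` of a 1-form. -/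
def covDeriv (g : R4 → Matrix (Fin 4) (Fin 4) ℝ) (w : R4 → Fin 4 → ℝ) (y : R4)
    (α β : Fin 4) : ℝ :=
  pd α (fun z => w z β) y - ∑ l, christoffel g l α β y * w y l

/-- The exterior derivative `(dw)_{αβ} = ∂_α w_β - ∂_β w_α` of a 1-form. -/
def extD (w : R4 → Fin 4 → ℝ) (y : R4) (α β : Fin 4) : ℝ :=
  pd α (fun z => w z β) y - pd β (fun z => w z α) y

/-- The exterior product `(a ∧ b)_{αβ} = a_α b_β - a_β b_α` of two 1-forms. -/
def wedge₁₁ (a b : Fin 4 → ℝ) (α β : Fin 4) : ℝ :=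
  a α * b β - a β * b α

/-- The exterior product `(a ∧ F)_{αβγ} = a_α F_{βγ} + a_β F_{γα} + a_γ F_{αβ}` of a 1-form and a
2-form. -/
def wedge₁₂ (a : Fin 4 → ℝ) (F : Fin 4 → Fin 4 → ℝ) (α β γ : Fin 4) : ℝ :=
  a α * F β γ + a β * F γ α + a γ * F α β

end Coord

/-! ### Spacetimes -/

section Manifold

variable (M : Type*) [TopologicalSpace M] [ChartedSpace R4 M] [IsManifold (𝓡 4) ∞ M]

/-- A smooth Lorentzian metric of signature `(-,+,+,+)` on the 4-dimensional manifold `M`: a smooth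
field of symmetric bilinear forms on the tangent spaces, each of which has an orthonormal basis with
exactly one timelike vector. -/
structure LorentzMetric where
  /-- The bilinear form on the tangent space at `p`. -/
  val (p : M) : TangentSpace (𝓡 4) p →L[ℝ] TangentSpace (𝓡 4) p →L[ℝ] ℝ
  symm (p : M) (v w : TangentSpace (𝓡 4) p) : val p v w = val p w v
  lorentzian (p : M) : ∃ b : Module.Basis (Fin 4) ℝ (TangentSpace (𝓡 4) p),
    ∀ i j, val p (b i) (b j) = if i = j then (if i = 0 then -1 else 1) else 0
  contMDiff : ContMDiff (𝓡 4) ((𝓡 4).prod 𝓘(ℝ, R4 →L[ℝ] R4 →L[ℝ] ℝ)) ∞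
    (fun p => Bundle.TotalSpace.mk' (R4 →L[ℝ] R4 →L[ℝ] ℝ)
      (E := fun p : M => TangentSpace (𝓡 4) p →L[ℝ] TangentSpace (𝓡 4) p →L[ℝ] ℝ) p (val p))

variable {M}

/-- A vector field on `M` is smooth. -/
def SmoothVectorField (ξ : (p : M) → TangentSpace (𝓡 4) p) : Prop :=
  ContMDiff (𝓡 4) (𝓡 4).tangent ∞ (fun p => (⟨p, ξ p⟩ : TangentBundle (𝓡 4) M))

/-- The coordinate vector field `∂/∂x^i` of the chart `e`, at the point with coordinates `y`. -/
def coordVector (e : OpenPartialHomeomorph M R4) (y : R4) (i : Fin 4) :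
    TangentSpace (𝓡 4) (e.symm y) :=
  mfderiv (𝓡 4) (𝓡 4) e.symm y (EuclideanSpace.single i (1 : ℝ) : R4)

/-- The components `g_{ij} = g(∂/∂x^i, ∂/∂x^j)` of the metric in the chart `e`. -/
def LorentzMetric.inChart (g : LorentzMetric M) (e : OpenPartialHomeomorph M R4) (y : R4) :
    Matrix (Fin 4) (Fin 4) ℝ :=
  Matrix.of fun i j => g.val (e.symm y) (coordVector e y i) (coordVector e y j)

/-- The components `ξ^i = dx^i(ξ)` of a vector field in the chart `e`. -/
def vecInChart (ξ : (p : M) → TangentSpace (𝓡 4) p) (e : OpenPartialHomeomorph M R4) (y : R4)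
    (i : Fin 4) : ℝ :=
  (show R4 from mfderiv (𝓡 4) (𝓡 4) e (e.symm y) (ξ (e.symm y))) i

/-- The covariant components `ξ_i` in the chart `e` of the 1-form `g(ξ, ·)`. -/
def formInChart (g : LorentzMetric M) (ξ : (p : M) → TangentSpace (𝓡 4) p)
    (e : OpenPartialHomeomorph M R4) : R4 → Fin 4 → ℝ :=
  Coord.lower (g.inChart e) (vecInChart ξ e)

/-- `ξ` is a Killing vector field: it is smooth and satisfies `∇_α ξ_β + ∇_β ξ_α = 0` in every
coordinate system. -/
def IsKilling (g : LorentzMetric M) (ξ : (p : M) → TangentSpace (𝓡 4) p) : Prop :=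
  SmoothVectorField ξ ∧ ∀ e ∈ IsManifold.maximalAtlas (𝓡 4) ∞ M, ∀ y ∈ e.target, ∀ α β,
    Coord.covDeriv (g.inChart e) (formInChart g ξ e) y α β
      + Coord.covDeriv (g.inChart e) (formInChart g ξ e) y β α = 0

/-- `v` is hypersurface-orthogonal: `v ∧ dv = 0` for the 1-form `v_α` in every coordinate system. -/
def IsHypersurfaceOrthogonal (g : LorentzMetric M) (v : (p : M) → TangentSpace (𝓡 4) p) : Prop :=
  ∀ e ∈ IsManifold.maximalAtlas (𝓡 4) ∞ M, ∀ y ∈ e.target, ∀ α β γ,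
    Coord.wedge₁₂ (formInChart g v e y) (Coord.extD (formInChart g v e) y) α β γ = 0

/-- The components `j_μ(ξ₁, ξ₂, ξ₃)` in the chart `e` of the Bel current of three vector fields. -/
def belCurrent₃ (g : LorentzMetric M) (ξ₁ ξ₂ ξ₃ : (p : M) → TangentSpace (𝓡 4) p)
    (e : OpenPartialHomeomorph M R4) : R4 → Fin 4 → ℝ :=
  Coord.current (g.inChart e) (vecInChart ξ₁ e) (vecInChart ξ₂ e) (vecInChart ξ₃ e)

/-- The components in the chart `e` of the Bel current `j(ξ) = j(ξ, ξ, ξ)`. -/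
def belCurrent (g : LorentzMetric M) (ξ : (p : M) → TangentSpace (𝓡 4) p)
    (e : OpenPartialHomeomorph M R4) : R4 → Fin 4 → ℝ :=
  belCurrent₃ g ξ ξ ξ e

end Manifold

end Spacetime

end

/-!
The argument is pointwise and does not depend on the causal character of `ξ`. Let `w` be the 1-form
of the Killing field `ξ`. By Killing's equation `C = ∇w` is antisymmetric, so `dw = 2 C` and
hypersurface-orthogonality reads `w ∧ C = 0`. Where `ξ` vanishes so does the Bel current; consider
a point with `w ≠ 0`. There `C = w ∧ θ` for a covector `θ` (`exists_wedge_factor`), hence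
`∇_a w ∧ C = 0`, and differentiating `w ∧ C = 0` gives `w ∧ ∇_a C = 0` (`wedge_covDeriv₂`). The Killing
identity `∇_a C_{βγ} = -R_{βγaδ} ξ^δ` (`covDeriv₂_killing`) turns this into a purely algebraic
restriction on the curvature (`exists_riemann_contract_eq`): for some tensor `A`,

  `R_{βγαδ} ξ^δ = w_β A_{αγ} - w_γ A_{αβ}`.

Contracting with `ξ^α` shows that `ξ^α A_{αγ}` is a multiple of `w_γ` (`exists_contract_eq`).
Inserting the restriction into the Bel tensor contracted three times with `ξ`, every term is a
multiple of `w_μ`: the terms with a factor `g_{λμ}` trivially; the first two because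
`R_{αρλσ} ξ^α ξ^λ` is annihilated by `ξ` (`exists_bel_square`); the remaining one by two uses of the property of
`A` (`exists_bel_trace`).

The symmetries of the Riemann tensor, the Ricci identity and the Killing identity are derived from
the coordinate formulas for the Christoffel symbols. The components of the metric and of `w` in a
chart are smooth because the coordinate vector fields are smooth sections of the tangent bundle.
-/

namespace Spacetime.Coord

open scoped Topology

/-! ### Partial derivatives -/
section pd
variable {f f' : R4 → ℝ} {y : R4} {U : Set R4}

theorem pd_add (i : Fin 4) (hf : DifferentiableAt ℝ f y) (hf' : DifferentiableAt ℝ f' y) :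
    pd i (fun z => f z + f' z) y = pd i f y + pd i f' y := by
  simp [pd, fderiv_fun_add hf hf']

theorem pd_sub (i : Fin 4) (hf : DifferentiableAt ℝ f y) (hf' : DifferentiableAt ℝ f' y) :
    pd i (fun z => f z - f' z) y = pd i f y - pd i f' y := by
  simp [pd, fderiv_fun_sub hf hf']

theorem pd_mul (i : Fin 4) (hf : DifferentiableAt ℝ f y) (hf' : DifferentiableAt ℝ f' y) :
    pd i (fun z => f z * f' z) y = pd i f y * f' y + f y * pd i f' y := by
  simp [pd, fderiv_fun_mul hf hf']; ring

theorem pd_const_mul (i : Fin 4) (c : ℝ) (hf : DifferentiableAt ℝ f y) :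
    pd i (fun z => c * f z) y = c * pd i f y := by
  simp [pd, fderiv_const_mul hf]

theorem pd_neg (i : Fin 4) : pd i (fun z => -f z) y = -pd i f y := by
  simp [pd]

theorem pd_sum (i : Fin 4) {F : Fin 4 → R4 → ℝ} (hF : ∀ k, DifferentiableAt ℝ (F k) y) :
    pd i (fun z => ∑ k, F k z) y = ∑ k, pd i (F k) y := by
  simp [pd, fderiv_fun_sum fun k _ => hF k]

theorem pd_congr (i : Fin 4) (hU : IsOpen U) (hy : y ∈ U) (h : ∀ z ∈ U, f z = f' z) :
    pd i f y = pd i f' y := by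
  have : f =ᶠ[𝓝 y] f' := Filter.eventually_of_mem (hU.mem_nhds hy) h
  simp [pd, this.fderiv_eq]

theorem contDiffOn_pd (i : Fin 4) (hU : IsOpen U) (hf : ContDiffOn ℝ ∞ f U) :
    ContDiffOn ℝ ∞ (pd i f) U :=
  (hf.fderiv_of_isOpen hU (by simp)).clm_apply contDiffOn_const

theorem differentiableAt_of_contDiffOn (hU : IsOpen U) (hy : y ∈ U) (hf : ContDiffOn ℝ ∞ f U) :
    DifferentiableAt ℝ f y :=
  (hf.contDiffAt (hU.mem_nhds hy)).differentiableAt (by simp)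

theorem pd_comm (i j : Fin 4) (hU : IsOpen U) (hy : y ∈ U) (hf : ContDiffOn ℝ ∞ f U) :
    pd i (pd j f) y = pd j (pd i f) y := by
  have h2 : DifferentiableAt ℝ (fderiv ℝ f) y :=
    ((hf.fderiv_of_isOpen (m := ∞) hU (by simp)).contDiffAt (hU.mem_nhds hy)).differentiableAt
      (by simp)
  have e : ∀ a b, pd a (pd b f) y
      = fderiv ℝ (fderiv ℝ f) y (EuclideanSpace.single a 1) (EuclideanSpace.single b 1) := by
    intro a b
    have hb : pd b f = fun z => fderiv ℝ f z (EuclideanSpace.single b (1 : ℝ)) := rfl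
    rw [hb, pd, fderiv_clm_apply h2 (differentiableAt_const _)]
    simp
  rw [e, e]
  exact (hf.contDiffAt (hU.mem_nhds hy)).isSymmSndFDerivAt
    (by simpa using WithTop.coe_le_coe.2 (le_top : (2 : ℕ∞) ≤ ⊤)) _ _

end pd

/-! ### Christoffel symbols and symmetries of the Riemann tensor -/

/-- The matrix-valued function `g` is, on the open set `U`, a smooth nondegenerate metric.
Symmetry is required everywhere, not only on `U`, so that the component functions `g_{ij}` and
`g_{ji}` are equal as functions; the components of a metric in a chart satisfy this. -/
structure IsSmoothMetricOn (g : R4 → Matrix (Fin 4) (Fin 4) ℝ) (U : Set R4) : Prop where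
  isOpen : IsOpen U
  symm : ∀ y i j, g y i j = g y j i
  contDiffOn : ∀ i j, ContDiffOn ℝ ∞ (fun z => g z i j) U
  det_ne_zero : ∀ y ∈ U, (g y).det ≠ 0

/-- Christoffel symbols of the first kind, `Γ_{kij} = ½ (∂_i g_{jk} + ∂_j g_{ik} - ∂_k g_{ij})`. -/
noncomputable def christoffelLower (g : R4 → Matrix (Fin 4) (Fin 4) ℝ) (k i j : Fin 4)
    (y : R4) : ℝ :=
  1 / 2 * (pd i (fun z => g z j k) y + pd j (fun z => g z i k) y - pd k (fun z => g z i j) y)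

theorem contDiffOn_det {A : R4 → Matrix (Fin 4) (Fin 4) ℝ} {U : Set R4}
    (hA : ∀ i j, ContDiffOn ℝ ∞ (fun z => A z i j) U) :
    ContDiffOn ℝ ∞ (fun z => (A z).det) U := by
  simp only [Matrix.det_apply]
  exact ContDiffOn.sum fun σ _ => (contDiffOn_prod fun i _ => hA _ _).const_smul _

namespace IsSmoothMetricOn
variable {g : R4 → Matrix (Fin 4) (Fin 4) ℝ} {U : Set R4} (hg : IsSmoothMetricOn g U)
include hg

theorem ginv_symm (y : R4) (i j : Fin 4) : ginv g y i j = ginv g y j i := by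
  have : (g y).transpose = g y := by ext i j; exact hg.symm y j i
  calc ginv g y i j = ((g y).transpose)⁻¹ i j := by rw [this]; rfl
    _ = _ := by rw [← Matrix.transpose_nonsing_inv]; rfl

theorem mul_ginv {y : R4} (hy : y ∈ U) : g y * ginv g y = 1 :=
  Matrix.mul_nonsing_inv _ (hg.det_ne_zero y hy).isUnit

theorem ginv_mul {y : R4} (hy : y ∈ U) : ginv g y * g y = 1 :=
  Matrix.nonsing_inv_mul _ (hg.det_ne_zero y hy).isUnit

theorem contDiffOn_ginv (i j : Fin 4) : ContDiffOn ℝ ∞ (fun z => ginv g z i j) U := by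
  have hadj : ContDiffOn ℝ ∞ (fun z => (g z).adjugate i j) U := by
    simp only [Matrix.adjugate_apply]
    refine contDiffOn_det fun k l => ?_
    by_cases hk : k = j
    · subst hk; simpa using contDiffOn_const
    · simpa [Matrix.updateRow_ne hk] using hg.contDiffOn k l
  have : ∀ z, ginv g z i j = ((g z).det)⁻¹ * (g z).adjugate i j := fun z => by
    simp [ginv, Matrix.inv_def]
  simp only [this]
  exact ((contDiffOn_det hg.contDiffOn).inv hg.det_ne_zero).mul hadj

theorem contDiffOn_christoffel (k i j : Fin 4) : ContDiffOn ℝ ∞ (christoffel g k i j) U :=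
  contDiffOn_const.mul (ContDiffOn.sum fun l _ => (hg.contDiffOn_ginv k l).mul
    (((contDiffOn_pd i hg.isOpen (hg.contDiffOn j l)).add
    (contDiffOn_pd j hg.isOpen (hg.contDiffOn i l))).sub
    (contDiffOn_pd l hg.isOpen (hg.contDiffOn i j))))

theorem component_symm (i j : Fin 4) : (fun z => g z i j) = fun z => g z j i :=
  funext fun z => hg.symm z i j

theorem christoffelLower_symm (k i j : Fin 4) :
    christoffelLower g k i j = christoffelLower g k j i := by
  funext y
  simp only [christoffelLower, hg.component_symm j i]; ring

theorem christoffel_symm (k i j : Fin 4) : christoffel g k i j = christoffel g k j i := by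
  funext y
  simp only [christoffel, hg.component_symm j i, add_comm (pd i _ y)]

omit hg in
theorem christoffel_eq (k i j : Fin 4) (y : R4) :
    christoffel g k i j y = ∑ l, ginv g y k l * christoffelLower g l i j y := by
  simp only [christoffel, christoffelLower, Finset.mul_sum]
  exact Finset.sum_congr rfl fun _ _ => by ring

theorem sum_mul_christoffel {y : R4} (hy : y ∈ U) (k i j : Fin 4) :
    ∑ l, g y k l * christoffel g l i j y = christoffelLower g k i j y := by
  have h1 : (fun l => christoffel g l i j y)
      = Matrix.mulVec (ginv g y) (fun l => christoffelLower g l i j y) := by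
    funext l; rw [christoffel_eq]; rfl
  have h2 : Matrix.mulVec (g y) (fun l => christoffel g l i j y)
      = fun l => christoffelLower g l i j y := by
    rw [h1, Matrix.mulVec_mulVec, hg.mul_ginv hy, Matrix.one_mulVec]
  exact congrFun h2 k

theorem pd_component (y : R4) (k i j : Fin 4) :
    pd k (fun z => g z i j) y = christoffelLower g i k j y + christoffelLower g j k i y := by
  simp only [christoffelLower, hg.component_symm j i]; ring

theorem diff_component {y : R4} (hy : y ∈ U) (i j : Fin 4) :
    DifferentiableAt ℝ (fun z => g z i j) y :=
  differentiableAt_of_contDiffOn hg.isOpen hy (hg.contDiffOn i j)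

theorem diff_christoffel {y : R4} (hy : y ∈ U) (k i j : Fin 4) :
    DifferentiableAt ℝ (christoffel g k i j) y :=
  differentiableAt_of_contDiffOn hg.isOpen hy (hg.contDiffOn_christoffel k i j)

/-- The derivative of `g_{kl} Γ^l_{ij} = Γ_{kij}`. It expresses the derivatives of `Γ^l_{ij}`
without differentiating the inverse metric. -/
theorem sum_mul_pd_christoffel {y : R4} (hy : y ∈ U) (m k i j : Fin 4) :
    ∑ l, g y k l * pd m (christoffel g l i j) y = pd m (christoffelLower g k i j) y
      - ∑ l, (christoffelLower g k m l y + christoffelLower g l m k y)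
        * christoffel g l i j y := by
  have h := pd_congr m hg.isOpen hy fun z hz => hg.sum_mul_christoffel hz k i j
  rw [pd_sum m fun l => (hg.diff_component hy k l).fun_mul (hg.diff_christoffel hy l i j)] at h
  have e : pd m (fun z => christoffelLower g k i j z) y = pd m (christoffelLower g k i j) y := rfl
  rw [← e, ← h, ← Finset.sum_sub_distrib]
  refine Finset.sum_congr rfl fun l _ => ?_
  rw [pd_mul m (hg.diff_component hy k l) (hg.diff_christoffel hy l i j), ← hg.pd_component]
  ring

/-- The fully covariant Riemann tensor in terms of Christoffel symbols of the first kind: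
`R_{αβμν} = ∂_μ Γ_{ανβ} - ∂_ν Γ_{αμβ} - Γ_{λμα} Γ^λ_{νβ} + Γ_{λνα} Γ^λ_{μβ}`. -/
theorem riemann_eq {y : R4} (hy : y ∈ U) (α β μ ν : Fin 4) :
    riemann g y α β μ ν = pd μ (christoffelLower g α ν β) y - pd ν (christoffelLower g α μ β) y
      - ∑ l, christoffelLower g l μ α y * christoffel g l ν β y
      + ∑ l, christoffelLower g l ν α y * christoffel g l μ β y := by
  have h1 := hg.sum_mul_pd_christoffel hy μ α ν β
  have h2 := hg.sum_mul_pd_christoffel hy ν α μ β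
  have h3 := fun i => hg.sum_mul_christoffel hy α μ i
  have h4 := fun i => hg.sum_mul_christoffel hy α ν i
  have e : ∀ i j, ∑ ρ, g y α ρ * ∑ l, christoffel g ρ i l y * christoffel g l j β y
      = ∑ l, (∑ ρ, g y α ρ * christoffel g ρ i l y) * christoffel g l j β y := by
    intro i j
    simp only [Finset.mul_sum, Finset.sum_mul]
    rw [Finset.sum_comm]
    exact Finset.sum_congr rfl fun _ _ => Finset.sum_congr rfl fun _ _ => by ring
  simp only [riemann, riemannUp, mul_sub, mul_add, Finset.sum_sub_distrib,
    Finset.sum_add_distrib, e, h1, h2, h3, h4, add_mul]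
  ring

/-- The products of Christoffel symbols in the fully covariant Riemann tensor form a symmetric
bilinear expression, because the inverse metric is symmetric. -/
theorem sum_christoffel_mul_comm (y : R4) (i j k l : Fin 4) :
    ∑ m, christoffelLower g m i j y * christoffel g m k l y
      = ∑ m, christoffelLower g m k l y * christoffel g m i j y := by
  simp only [christoffel_eq, Finset.mul_sum]
  rw [Finset.sum_comm]
  refine Finset.sum_congr rfl fun a _ => Finset.sum_congr rfl fun b _ => ?_
  rw [hg.ginv_symm y b a]; ring

theorem pd_christoffelLower {y : R4} (hy : y ∈ U) (m k i j : Fin 4) :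
    pd m (christoffelLower g k i j) y = 1 / 2 * (pd m (pd i fun z => g z j k) y
      + pd m (pd j fun z => g z i k) y - pd m (pd k fun z => g z i j) y) := by
  have hd : ∀ a b c, DifferentiableAt ℝ (pd a fun z => g z b c) y := fun a b c =>
    differentiableAt_of_contDiffOn hg.isOpen hy (contDiffOn_pd a hg.isOpen (hg.contDiffOn b c))
  have e : christoffelLower g k i j = fun z => 1 / 2 * (pd i (fun z => g z j k) z
    + pd j (fun z => g z i k) z - pd k (fun z => g z i j) z) := rfl
  rw [e, pd_const_mul m _ (((hd _ _ _).fun_add (hd _ _ _)).fun_sub (hd _ _ _)),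
    pd_sub m ((hd _ _ _).fun_add (hd _ _ _)) (hd _ _ _), pd_add m (hd _ _ _) (hd _ _ _)]

omit hg in
theorem riemann_antisymm_snd (y : R4) (α β μ ν : Fin 4) :
    riemann g y α β μ ν = -riemann g y α β ν μ := by
  simp only [riemann, riemannUp, ← Finset.sum_neg_distrib]
  exact Finset.sum_congr rfl fun _ _ => by ring

theorem riemann_antisymm_fst {y : R4} (hy : y ∈ U) (α β μ ν : Fin 4) :
    riemann g y α β μ ν = -riemann g y β α μ ν := by
  have c : ∀ i j a b, pd i (pd j fun z => g z a b) y = pd j (pd i fun z => g z a b) y :=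
    fun i j a b => pd_comm i j hg.isOpen hy (hg.contDiffOn a b)
  have s := hg.component_symm
  rw [hg.riemann_eq hy, hg.riemann_eq hy, hg.sum_christoffel_mul_comm y μ α ν β,
    hg.sum_christoffel_mul_comm y ν α μ β]
  simp only [hg.pd_christoffelLower hy]
  rw [s β α, c μ ν α β]
  ring

theorem riemann_pair_symm {y : R4} (hy : y ∈ U) (α β μ ν : Fin 4) :
    riemann g y α β μ ν = riemann g y μ ν α β := by
  have c : ∀ i j a b, pd i (pd j fun z => g z a b) y = pd j (pd i fun z => g z a b) y :=
    fun i j a b => pd_comm i j hg.isOpen hy (hg.contDiffOn a b)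
  have s := hg.component_symm
  have t := hg.christoffelLower_symm
  have u := hg.christoffel_symm
  rw [hg.riemann_eq hy, hg.riemann_eq hy, hg.sum_christoffel_mul_comm y β μ α ν]
  simp only [hg.pd_christoffelLower hy, t _ α μ, t _ α ν, u _ β ν, u _ β μ]
  rw [s μ α, s ν α, s μ β, s ν β, c α β, c α ν, c α μ, c β μ, c β ν, c μ ν]
  ring

/-- The first Bianchi identity. -/
theorem riemann_cyclic (y : R4) (α β μ ν : Fin 4) :
    riemann g y α β μ ν + riemann g y α μ ν β + riemann g y α ν β μ = 0 := by
  have u := hg.christoffel_symm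
  simp only [riemann, riemannUp, ← Finset.sum_add_distrib]
  refine Finset.sum_eq_zero fun ρ _ => ?_
  simp only [u _ ν β, u _ μ β, u _ ν μ]
  ring

end IsSmoothMetricOn

/-! ### Algebra of the Bel tensor -/

/-- Division lemma: a 2-form `C` with `w ∧ C = 0`, `w ≠ 0`, is a product `w ∧ θ`. -/
theorem exists_wedge_factor {w : Fin 4 → ℝ} {C : Fin 4 → Fin 4 → ℝ} (hw : w ≠ 0)
    (hC : ∀ β γ, C β γ = -C γ β) (h : ∀ α β γ, wedge₁₂ w C α β γ = 0) :
    ∃ θ : Fin 4 → ℝ, ∀ β γ, C β γ = w β * θ γ - w γ * θ β := by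
  obtain ⟨i, hi⟩ := Function.ne_iff.1 hw
  simp only [Pi.zero_apply] at hi
  refine ⟨fun γ => C i γ / w i, fun β γ => ?_⟩
  have h1 := h i β γ
  have h2 := hC i γ
  simp only [wedge₁₂] at h1
  field_simp
  linear_combination h1 - w β * h2

/-- A contraction with `x` can be carried out inside a sum over any system of other indices. -/
theorem contract_fst {ι : Type*} [Fintype ι] (x : Fin 4 → ℝ) (c Q : ι → ℝ) (P : Fin 4 → ι → ℝ) :
    ∑ a, (∑ i, c i * (P a i * Q i)) * x a = ∑ i, c i * ((∑ a, P a i * x a) * Q i) := by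
  simp only [Finset.sum_mul, Finset.mul_sum]
  rw [Finset.sum_comm]
  exact Finset.sum_congr rfl fun _ _ => Finset.sum_congr rfl fun _ _ => by ring

/-- The variant of `contract_fst` in which the contracted factor stands last. -/
theorem contract_snd {ι : Type*} [Fintype ι] (x : Fin 4 → ℝ) (c Q : ι → ℝ) (P : Fin 4 → ι → ℝ) :
    ∑ a, (∑ i, c i * (Q i * P a i)) * x a = ∑ i, c i * (Q i * ∑ a, P a i * x a) := by
  simp only [Finset.sum_mul, Finset.mul_sum]
  rw [Finset.sum_comm]
  exact Finset.sum_congr rfl fun _ _ => Finset.sum_congr rfl fun _ _ => by ring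

section
variable {h : Matrix (Fin 4) (Fin 4) ℝ} {R : Fin 4 → Fin 4 → Fin 4 → Fin 4 → ℝ}
  {x w : Fin 4 → ℝ} {A : Fin 4 → Fin 4 → ℝ}

theorem contract_riemann_fst (R34 : ∀ a b c d, R a b c d = -R a b d c)
    (Rp : ∀ a b c d, R a b c d = R c d a b)
    (hA : ∀ β γ α, ∑ δ, R β γ α δ * x δ = w β * A α γ - w γ * A α β) (ρ μ σ : Fin 4) :
    ∑ β, R β ρ μ σ * x β = w σ * A ρ μ - w μ * A ρ σ := by
  have := hA μ σ ρ
  rw [Finset.sum_congr rfl (fun β _ => by rw [Rp β ρ μ σ, R34 μ σ β ρ, neg_mul]),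
    Finset.sum_neg_distrib, this]
  ring

theorem contract_riemann_thd (R34 : ∀ a b c d, R a b c d = -R a b d c)
    (hA : ∀ β γ α, ∑ δ, R β γ α δ * x δ = w β * A α γ - w γ * A α β) (ρ τ σ : Fin 4) :
    ∑ l, R ρ τ l σ * x l = w τ * A σ ρ - w ρ * A σ τ := by
  have := hA ρ τ σ
  rw [Finset.sum_congr rfl (fun β _ => by rw [R34 ρ τ β σ, neg_mul]),
    Finset.sum_neg_distrib, this]
  ring

/-- If `R_{βγαδ} x^δ = w_β A_{αγ} - w_γ A_{αβ}`, the contraction of `A` with `x` is a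
multiple of `w`. This follows from contracting the hypothesis with `x^α`, which kills the
left-hand side. -/
theorem exists_contract_eq (hw : w ≠ 0) (R34 : ∀ a b c d, R a b c d = -R a b d c)
    (hA : ∀ β γ α, ∑ δ, R β γ α δ * x δ = w β * A α γ - w γ * A α β) :
    ∃ s : ℝ, ∀ γ, ∑ α, x α * A α γ = s * w γ := by
  -- the two 1-forms `w` and `x^α A_{αγ}` have vanishing exterior product
  have key : ∀ β γ, w β * ∑ α, x α * A α γ = w γ * ∑ α, x α * A α β := by
    intro β γ
    have h0 : ∑ α, (∑ δ, R β γ α δ * x δ) * x α = 0 := by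
      have : ∑ α, (∑ δ, R β γ α δ * x δ) * x α = -∑ α, (∑ δ, R β γ α δ * x δ) * x α := by
        simp only [Finset.sum_mul]
        conv_lhs => rw [Finset.sum_comm]
        simp only [← Finset.sum_neg_distrib]
        exact Finset.sum_congr rfl fun a _ => Finset.sum_congr rfl fun b _ => by
          rw [R34 β γ b a]; ring
      linarith
    simp only [hA] at h0
    simp only [Fin.sum_univ_four] at h0 ⊢
    linear_combination h0
  obtain ⟨i, hi⟩ := Function.ne_iff.1 hw
  simp only [Pi.zero_apply] at hi
  refine ⟨(∑ α, x α * A α i) / w i, fun γ => ?_⟩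
  have := key i γ
  field_simp
  linarith

/-- The contraction `R_{αρλσ} R_β^ρ_μ^σ x^α x^β x^λ` is a multiple of `w_μ`. With
`E_{ρσ} = R_{αρλσ} x^α x^λ` it equals `E^{ρσ} (w_σ A_{ρμ} - w_μ A_{ρσ})`, and `E_{ρσ} x^σ = 0`. -/
theorem exists_bel_square (hx : ∀ i, x i = ∑ j, h i j * w j)
    (R34 : ∀ a b c d, R a b c d = -R a b d c)
    (Rp : ∀ a b c d, R a b c d = R c d a b)
    (hA : ∀ β γ α, ∑ δ, R β γ α δ * x δ = w β * A α γ - w γ * A α β) :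
    ∃ c : ℝ, ∀ μ, ∑ α, ∑ β, ∑ l, (∑ ρ, ∑ ρ', ∑ σ, ∑ σ', h ρ ρ' * h σ σ' *
      (R α ρ l σ * R β ρ' μ σ')) * x α * x β * x l = c * w μ := by
  set E : Fin 4 → Fin 4 → ℝ := fun ρ σ => ∑ l, (∑ α, R α ρ l σ * x α) * x l with hE
  -- `E_{ρσ} x^σ = 0` because `R` is antisymmetric in its last two indices
  have hE0 : ∀ ρ, ∑ σ, E ρ σ * x σ = 0 := by
    intro ρ
    have : ∑ σ, E ρ σ * x σ = -∑ σ, E ρ σ * x σ := by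
      simp only [hE, Finset.sum_mul]
      conv_lhs => rw [Finset.sum_comm]
      simp only [← Finset.sum_neg_distrib]
      exact Finset.sum_congr rfl fun a _ => Finset.sum_congr rfl fun b _ =>
        Finset.sum_congr rfl fun c _ => by rw [R34 c ρ a b]; ring
    linarith
  refine ⟨-∑ ρ, ∑ ρ', ∑ σ, ∑ σ', h ρ ρ' * h σ σ' * (E ρ σ * A ρ' σ'), fun μ => ?_⟩
  have step : ∑ α, ∑ β, ∑ l, (∑ ρ, ∑ ρ', ∑ σ, ∑ σ', h ρ ρ' * h σ σ' *
      (R α ρ l σ * R β ρ' μ σ')) * x α * x β * x l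
      = ∑ ρ, ∑ ρ', ∑ σ, ∑ σ', h ρ ρ' * h σ σ' * (E ρ σ * (w σ' * A ρ' μ - w μ * A ρ' σ')) := by
    have : ∀ α β l, (∑ ρ, ∑ ρ', ∑ σ, ∑ σ', h ρ ρ' * h σ σ' * (R α ρ l σ * R β ρ' μ σ'))
        = ∑ i : Fin 4 × Fin 4 × Fin 4 × Fin 4, (h i.1 i.2.1 * h i.2.2.1 i.2.2.2) *
          (R α i.1 l i.2.2.1 * R β i.2.1 μ i.2.2.2) := by
      intro α β l; simp only [Fintype.sum_prod_type]
    simp only [this]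
    calc _ = ∑ l, (∑ β, (∑ α, (∑ i : Fin 4 × Fin 4 × Fin 4 × Fin 4,
            (h i.1 i.2.1 * h i.2.2.1 i.2.2.2) *
          (R α i.1 l i.2.2.1 * R β i.2.1 μ i.2.2.2)) * x α) * x β) * x l := by
          simp only [Finset.sum_mul _ _ (x _)]
          rw [Finset.sum_comm]
          conv_rhs => rw [Finset.sum_comm]
          exact Finset.sum_congr rfl fun _ _ => Finset.sum_comm
      _ = _ := by
          simp only [contract_fst, contract_snd, contract_riemann_fst R34 Rp hA]
          simp only [Fintype.sum_prod_type, hE, contract_riemann_fst R34 Rp hA]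
  rw [step]
  have inner : ∀ ρ ρ', ∑ σ, ∑ σ', h ρ ρ' * h σ σ' * (E ρ σ * (w σ' * A ρ' μ - w μ * A ρ' σ'))
      = - (∑ σ, ∑ σ', h ρ ρ' * h σ σ' * (E ρ σ * A ρ' σ')) * w μ := by
    intro ρ ρ'
    have h1 : ∀ σ, ∑ σ', h ρ ρ' * h σ σ' * (E ρ σ * (w σ' * A ρ' μ - w μ * A ρ' σ'))
       = h ρ ρ' * A ρ' μ * (E ρ σ * x σ) - (∑ σ', h ρ ρ' * h σ σ' * (E ρ σ * A ρ' σ')) * w μ := by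
      intro σ
      rw [hx σ]
      simp only [Finset.mul_sum, Finset.sum_mul, ← Finset.sum_sub_distrib]
      exact Finset.sum_congr rfl fun _ _ => by ring
    simp only [h1, Finset.sum_sub_distrib, ← Finset.mul_sum, hE0, ← Finset.sum_mul]
    ring
  simp only [inner, Finset.sum_neg_distrib, neg_mul, Finset.sum_mul]

/-- The contraction `R_{ρτλσ} R^{ρτ}_μ^σ x^λ` is a multiple of `w_μ`. Up to sign it equals
`2 A^{στ} (w_σ A_{τμ} - w_μ A_{τσ})`, and `A^{στ} w_σ A_{τμ}` is a multiple of `w_μ` by two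
applications of `exists_contract_eq`. -/
theorem exists_bel_trace (hw : w ≠ 0) (hs : ∀ i j, h i j = h j i)
    (hx : ∀ i, x i = ∑ j, h i j * w j)
    (R12 : ∀ a b c d, R a b c d = -R b a c d)
    (R34 : ∀ a b c d, R a b c d = -R a b d c)
    (Rp : ∀ a b c d, R a b c d = R c d a b)
    (hA : ∀ β γ α, ∑ δ, R β γ α δ * x δ = w β * A α γ - w γ * A α β) :
    ∃ c : ℝ, ∀ μ, ∑ l, (∑ ρ, ∑ ρ', ∑ τ, ∑ τ', ∑ σ, ∑ σ',
        h ρ ρ' * h τ τ' * h σ σ' * (R ρ τ l σ * R ρ' τ' μ σ')) * x l = c * w μ := by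
  obtain ⟨s, hs'⟩ := exists_contract_eq hw R34 hA
  have hx' : ∀ i, ∑ j, h j i * w j = x i := fun i => by
    rw [hx i]; exact Finset.sum_congr rfl fun j _ => by rw [hs]
  refine ⟨2 * ((∑ τ, ∑ τ', ∑ σ, ∑ σ', h τ τ' * h σ σ' * (A σ τ * A τ' σ')) - s * s), fun μ => ?_⟩
  have step : ∑ l, (∑ ρ, ∑ ρ', ∑ τ, ∑ τ', ∑ σ, ∑ σ',
        h ρ ρ' * h τ τ' * h σ σ' * (R ρ τ l σ * R ρ' τ' μ σ')) * x l
      = ∑ ρ, ∑ ρ', ∑ τ, ∑ τ', ∑ σ, ∑ σ',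
        h ρ ρ' * h τ τ' * h σ σ' * ((w τ * A σ ρ - w ρ * A σ τ) * R ρ' τ' μ σ') := by
    have : ∀ l, (∑ ρ, ∑ ρ', ∑ τ, ∑ τ', ∑ σ, ∑ σ',
        h ρ ρ' * h τ τ' * h σ σ' * (R ρ τ l σ * R ρ' τ' μ σ'))
        = ∑ i : Fin 4 × Fin 4 × Fin 4 × Fin 4 × Fin 4 × Fin 4,
          (h i.1 i.2.1 * h i.2.2.1 i.2.2.2.1 * h i.2.2.2.2.1 i.2.2.2.2.2) *
          (R i.1 i.2.2.1 l i.2.2.2.2.1 * R i.2.1 i.2.2.2.1 μ i.2.2.2.2.2) := by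
      intro l; simp only [Fintype.sum_prod_type]
    simp only [this, contract_fst, contract_riemann_thd R34 hA]
    simp only [Fintype.sum_prod_type]
  -- the common value, up to sign, of the contributions of `w_ρ A_{στ}` and of `w_τ A_{σρ}`
  have half : ∑ τ, ∑ τ', ∑ σ, ∑ σ', h τ τ' * h σ σ' * (A σ τ * ∑ ρ', R ρ' τ' μ σ' * x ρ')
      = s * s * w μ - (∑ τ, ∑ τ', ∑ σ, ∑ σ', h τ τ' * h σ σ' * (A σ τ * A τ' σ')) * w μ := by
    simp only [contract_riemann_fst R34 Rp hA]
    have e : ∀ τ τ' σ σ', h τ τ' * h σ σ' * (A σ τ * (w σ' * A τ' μ - w μ * A τ' σ'))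
      = h τ τ' * A τ' μ * A σ τ * (h σ σ' * w σ')
        - (h τ τ' * h σ σ' * (A σ τ * A τ' σ')) * w μ := by intros; ring
    simp only [e, Finset.sum_sub_distrib, ← Finset.sum_mul, ← Finset.mul_sum, ← hx]
    congr 1
    have e2 : ∀ τ τ', ∑ σ, h τ τ' * A τ' μ * A σ τ * x σ = s * (A τ' μ * (h τ τ' * w τ)) := by
      intro τ τ'
      have : ∀ σ, h τ τ' * A τ' μ * A σ τ * x σ = h τ τ' * A τ' μ * (x σ * A σ τ) := by
        intros; ring
      simp only [this, ← Finset.mul_sum, hs']; ring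
    simp only [e2]
    rw [Finset.sum_comm]
    simp only [← Finset.mul_sum, hx']
    have : ∀ i, A i μ * x i = x i * A i μ := fun i => mul_comm _ _
    simp only [this, hs']; ring
  have h1 : ∑ ρ, ∑ ρ', ∑ τ, ∑ τ', ∑ σ, ∑ σ',
        h ρ ρ' * h τ τ' * h σ σ' * ((w ρ * A σ τ) * R ρ' τ' μ σ')
      = ∑ τ, ∑ τ', ∑ σ, ∑ σ', h τ τ' * h σ σ' * (A σ τ * ∑ ρ', R ρ' τ' μ σ' * x ρ') := by
    simp only [← hx', Finset.mul_sum]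
    have : ∀ f : Fin 4 → Fin 4 → Fin 4 → Fin 4 → Fin 4 → Fin 4 → ℝ,
        ∑ ρ, ∑ ρ', ∑ τ, ∑ τ', ∑ σ, ∑ σ', f ρ ρ' τ τ' σ σ'
        = ∑ τ, ∑ τ', ∑ σ, ∑ σ', ∑ ρ', ∑ ρ, f ρ ρ' τ τ' σ σ' := by
      intro f
      let φ : (Fin 4 × Fin 4 × Fin 4 × Fin 4 × Fin 4 × Fin 4) ≃
          (Fin 4 × Fin 4 × Fin 4 × Fin 4 × Fin 4 × Fin 4) :=
        ⟨fun i => (i.2.2.1, i.2.2.2.1, i.2.2.2.2.1, i.2.2.2.2.2, i.2.1, i.1),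
         fun i => (i.2.2.2.2.2, i.2.2.2.2.1, i.1, i.2.1, i.2.2.1, i.2.2.2.1),
         fun _ => rfl, fun _ => rfl⟩
      have := Fintype.sum_equiv φ
        (fun i => f i.1 i.2.1 i.2.2.1 i.2.2.2.1 i.2.2.2.2.1 i.2.2.2.2.2)
        (fun i => f i.2.2.2.2.2 i.2.2.2.2.1 i.1 i.2.1 i.2.2.1 i.2.2.2.1) fun _ => rfl
      simpa only [Fintype.sum_prod_type] using this
    rw [this]
    refine Finset.sum_congr rfl fun τ _ => Finset.sum_congr rfl fun τ' _ =>
      Finset.sum_congr rfl fun σ _ => Finset.sum_congr rfl fun σ' _ =>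
      Finset.sum_congr rfl fun ρ' _ => Finset.sum_congr rfl fun ρ _ => ?_
    ring
  have h2 : ∑ ρ, ∑ ρ', ∑ τ, ∑ τ', ∑ σ, ∑ σ',
        h ρ ρ' * h τ τ' * h σ σ' * ((w τ * A σ ρ) * R ρ' τ' μ σ')
      = -∑ ρ, ∑ ρ', ∑ τ, ∑ τ', ∑ σ, ∑ σ',
        h ρ ρ' * h τ τ' * h σ σ' * ((w ρ * A σ τ) * R ρ' τ' μ σ') := by
    have : ∀ f : Fin 4 → Fin 4 → Fin 4 → Fin 4 → Fin 4 → Fin 4 → ℝ,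
        ∑ ρ, ∑ ρ', ∑ τ, ∑ τ', ∑ σ, ∑ σ', f ρ ρ' τ τ' σ σ'
        = ∑ ρ, ∑ ρ', ∑ τ, ∑ τ', ∑ σ, ∑ σ', f τ τ' ρ ρ' σ σ' := by
      intro f
      let φ : (Fin 4 × Fin 4 × Fin 4 × Fin 4 × Fin 4 × Fin 4) ≃
          (Fin 4 × Fin 4 × Fin 4 × Fin 4 × Fin 4 × Fin 4) :=
        ⟨fun i => (i.2.2.1, i.2.2.2.1, i.1, i.2.1, i.2.2.2.2.1, i.2.2.2.2.2),
         fun i => (i.2.2.1, i.2.2.2.1, i.1, i.2.1, i.2.2.2.2.1, i.2.2.2.2.2),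
         fun _ => rfl, fun _ => rfl⟩
      have := Fintype.sum_equiv φ
        (fun i => f i.1 i.2.1 i.2.2.1 i.2.2.2.1 i.2.2.2.2.1 i.2.2.2.2.2)
        (fun i => f i.2.2.1 i.2.2.2.1 i.1 i.2.1 i.2.2.2.2.1 i.2.2.2.2.2) fun _ => rfl
      simpa only [Fintype.sum_prod_type] using this
    rw [this]
    simp only [← Finset.sum_neg_distrib]
    refine Finset.sum_congr rfl fun τ _ => Finset.sum_congr rfl fun τ' _ =>
      Finset.sum_congr rfl fun σ _ => Finset.sum_congr rfl fun σ' _ =>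
      Finset.sum_congr rfl fun ρ' _ => Finset.sum_congr rfl fun ρ _ => ?_
    rw [R12 σ' τ']; ring
  rw [step]
  simp only [sub_mul, mul_sub, Finset.sum_sub_distrib, h2, h1, half]
  ring
end

/-- In the current `j(v, v, v)` the symmetrization of the Bel tensor has no effect. -/
theorem current_self (g : R4 → Matrix (Fin 4) (Fin 4) ℝ) (v : R4 → Fin 4 → ℝ) (y : R4)
    (μ : Fin 4) :
    current g v v v y μ = ∑ α, ∑ β, ∑ l, bel g y α β l μ * v y α * v y β * v y l := by
  have swap₁ : ∀ f : Fin 4 → Fin 4 → Fin 4 → ℝ,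
      ∑ α, ∑ β, ∑ l, f β α l * v y α * v y β * v y l
        = ∑ α, ∑ β, ∑ l, f α β l * v y α * v y β * v y l := by
    intro f
    rw [Finset.sum_comm]
    exact Finset.sum_congr rfl fun _ _ => Finset.sum_congr rfl fun _ _ =>
      Finset.sum_congr rfl fun _ _ => by ring
  have swap₂ : ∀ f : Fin 4 → Fin 4 → Fin 4 → ℝ,
      ∑ α, ∑ β, ∑ l, f α l β * v y α * v y β * v y l
        = ∑ α, ∑ β, ∑ l, f α β l * v y α * v y β * v y l := by
    intro f
    refine Finset.sum_congr rfl fun _ _ => ?_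
    rw [Finset.sum_comm]
    exact Finset.sum_congr rfl fun _ _ => Finset.sum_congr rfl fun _ _ => by ring
  have e₁ := swap₁ fun α β l => bel g y α β l μ
  have e₂ := swap₂ fun α β l => bel g y α β l μ
  have e₃ := swap₁ fun α β l => bel g y α l β μ
  have e₄ := swap₂ fun α β l => bel g y β α l μ
  have e₅ := swap₁ fun α β l => bel g y l α β μ
  simp only [current, belSymm, add_mul, mul_add, mul_assoc, Finset.sum_add_distrib,
    ← Finset.mul_sum] at e₁ e₂ e₃ e₄ e₅ ⊢
  linarith

/-- The algebraic core: if `R_{βγαδ} v^δ = w_β A_{αγ} - w_γ A_{αβ}` with `w_i = g_{ij} v^j ≠ 0`,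
then the Bel current of `v` is a multiple of `w`. -/
theorem exists_current_eq_smul {g : R4 → Matrix (Fin 4) (Fin 4) ℝ} {v : R4 → Fin 4 → ℝ}
    {y : R4} {A : Fin 4 → Fin 4 → ℝ} (hw : lower g v y ≠ 0) (gs : ∀ i j, g y i j = g y j i)
    (hs : ∀ i j, ginv g y i j = ginv g y j i) (hx : ∀ i, v y i = ∑ j, ginv g y i j * lower g v y j)
    (R12 : ∀ a b c d, riemann g y a b c d = -riemann g y b a c d)
    (R34 : ∀ a b c d, riemann g y a b c d = -riemann g y a b d c)
    (Rp : ∀ a b c d, riemann g y a b c d = riemann g y c d a b)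
    (hA : ∀ β γ α, ∑ δ, riemann g y β γ α δ * v y δ
      = lower g v y β * A α γ - lower g v y γ * A α β) :
    ∃ c : ℝ, ∀ μ, current g v v v y μ = c * lower g v y μ := by
  obtain ⟨c₁, h₁⟩ := exists_bel_square hx R34 Rp hA
  obtain ⟨c₃, h₃⟩ := exists_bel_trace hw hs hx R12 R34 Rp hA
  set h := ginv g y
  set R := riemann g y
  set x := v y
  -- the second term is the first one with the roles of `α`, `β` exchanged
  have h₂ : ∀ μ, ∑ α, ∑ β, ∑ l, (∑ ρ, ∑ ρ', ∑ σ, ∑ σ', h ρ ρ' * h σ σ' *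
      (R α ρ μ σ * R β ρ' l σ')) * x α * x β * x l = c₁ * lower g v y μ := by
    intro μ
    rw [← h₁ μ, Finset.sum_comm]
    refine Finset.sum_congr rfl fun α _ => Finset.sum_congr rfl fun β _ =>
      Finset.sum_congr rfl fun l _ => ?_
    have : ∑ ρ, ∑ ρ', ∑ σ, ∑ σ', h ρ ρ' * h σ σ' * (R β ρ μ σ * R α ρ' l σ')
        = ∑ ρ, ∑ ρ', ∑ σ, ∑ σ', h ρ ρ' * h σ σ' * (R α ρ l σ * R β ρ' μ σ') := by
      rw [Finset.sum_comm]
      refine Finset.sum_congr rfl fun ρ _ => Finset.sum_congr rfl fun ρ' _ => ?_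
      rw [Finset.sum_comm]
      refine Finset.sum_congr rfl fun σ _ => Finset.sum_congr rfl fun σ' _ => ?_
      rw [hs ρ' ρ, hs σ' σ]; ring
    rw [this]; ring
  have hlow : ∀ μ, ∑ l, g y l μ * x l = lower g v y μ := fun μ =>
    Finset.sum_congr rfl fun l _ => by rw [gs l μ]
  set N := ∑ α, ∑ β, g y α β * x α * x β
  -- the terms with a factor `g_{λμ}` are multiples of `w_μ` whatever the other factor is
  have h₄ : ∀ (Q : Fin 4 → Fin 4 → ℝ) (μ : Fin 4), ∑ α, ∑ β, ∑ l,
      (Q α β * g y l μ) * x α * x β * x l = (∑ α, ∑ β, Q α β * x α * x β) * lower g v y μ := by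
    intro Q μ
    simp only [← hlow μ, Finset.sum_mul]
    refine Finset.sum_congr rfl fun α _ => Finset.sum_congr rfl fun β _ => ?_
    rw [Finset.mul_sum]
    exact Finset.sum_congr rfl fun l _ => by ring
  have h₃' : ∀ T : Fin 4 → ℝ, ∑ α, ∑ β, ∑ l, (g y α β * T l) * x α * x β * x l
      = N * ∑ l, T l * x l := by
    intro T
    simp only [N, Finset.sum_mul]
    refine Finset.sum_congr rfl fun α _ => Finset.sum_congr rfl fun β _ => ?_
    rw [Finset.mul_sum]
    exact Finset.sum_congr rfl fun l _ => by ring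
  let Q : Fin 4 → Fin 4 → ℝ := fun α β => -(1 / 2) * (∑ ρ, ∑ ρ', ∑ σ, ∑ σ', ∑ τ, ∑ τ',
        h ρ ρ' * h σ σ' * h τ τ' * (R α ρ σ τ * R β ρ' σ' τ'))
      + 1 / 8 * g y α β * (∑ ρ, ∑ ρ', ∑ τ, ∑ τ', ∑ σ, ∑ σ', ∑ ν, ∑ ν',
        h ρ ρ' * h τ τ' * h σ σ' * h ν ν' * (R ρ τ σ ν * R ρ' τ' σ' ν'))
  refine ⟨c₁ + c₁ - 1 / 2 * (N * c₃) + ∑ α, ∑ β, Q α β * x α * x β, fun μ => ?_⟩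
  let T : Fin 4 → ℝ := fun l => ∑ ρ, ∑ ρ', ∑ τ, ∑ τ', ∑ σ, ∑ σ',
        h ρ ρ' * h τ τ' * h σ σ' * (R ρ τ l σ * R ρ' τ' μ σ')
  have hb : ∀ α β l, bel g y α β l μ * x α * x β * x l
      = (∑ ρ, ∑ ρ', ∑ σ, ∑ σ', h ρ ρ' * h σ σ' * (R α ρ l σ * R β ρ' μ σ')) * x α * x β * x l
      + (∑ ρ, ∑ ρ', ∑ σ, ∑ σ', h ρ ρ' * h σ σ' * (R α ρ μ σ * R β ρ' l σ')) * x α * x β * x l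
      - 1 / 2 * ((g y α β * T l) * x α * x β * x l)
      + (Q α β * g y l μ) * x α * x β * x l := by
    intro α β l
    simp only [bel, Q, T]
    ring
  rw [current_self]
  simp only [show v y = x from rfl, hb, Finset.sum_add_distrib, Finset.sum_sub_distrib,
    ← Finset.mul_sum, h₁, h₂, h₃', h₄, T, h₃]
  ring

/-! ### Hypersurface-orthogonal Killing fields in coordinates -/

/-- The second covariant derivative `∇_a ∇_β w_γ` of a 1-form. -/
noncomputable def covDeriv₂ (g : R4 → Matrix (Fin 4) (Fin 4) ℝ) (w : R4 → Fin 4 → ℝ) (y : R4)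
    (a β γ : Fin 4) : ℝ :=
  pd a (fun z => covDeriv g w z β γ) y - ∑ l, christoffel g l a β y * covDeriv g w y l γ
    - ∑ l, christoffel g l a γ y * covDeriv g w y β l

namespace IsSmoothMetricOn
variable {g : R4 → Matrix (Fin 4) (Fin 4) ℝ} {U : Set R4} {w : R4 → Fin 4 → ℝ} {y : R4}
  (hg : IsSmoothMetricOn g U) (hw : ∀ i, ContDiffOn ℝ ∞ (fun z => w z i) U)
include hg hw

theorem contDiffOn_covDeriv (β γ : Fin 4) :
    ContDiffOn ℝ ∞ (fun z => covDeriv g w z β γ) U :=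
  (contDiffOn_pd β hg.isOpen (hw γ)).sub
    (ContDiffOn.sum fun l _ => (hg.contDiffOn_christoffel l β γ).mul (hw l))

theorem pd_covDeriv (hy : y ∈ U) (a β γ : Fin 4) :
    pd a (fun z => covDeriv g w z β γ) y = pd a (pd β fun z => w z γ) y
      - ∑ l, (pd a (christoffel g l β γ) y * w y l
        + christoffel g l β γ y * pd a (fun z => w z l) y) := by
  have hc := fun l => hg.diff_christoffel hy l β γ
  have hd := fun l => differentiableAt_of_contDiffOn hg.isOpen hy (hw l)
  have hp := differentiableAt_of_contDiffOn hg.isOpen hy (contDiffOn_pd β hg.isOpen (hw γ))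
  have hs : DifferentiableAt ℝ (fun z => ∑ l, christoffel g l β γ z * w z l) y :=
    DifferentiableAt.fun_sum fun l _ => (hc l).fun_mul (hd l)
  simp only [covDeriv]
  rw [pd_sub a hp hs, pd_sum a fun l => (hc l).fun_mul (hd l)]
  congr 1
  exact Finset.sum_congr rfl fun l _ => pd_mul a (hc l) (hd l)

/-- The Ricci identity `[∇_a, ∇_β] w_γ = -R^λ_{γaβ} w_λ`. -/
theorem covDeriv₂_sub (hy : y ∈ U) (a β γ : Fin 4) :
    covDeriv₂ g w y a β γ - covDeriv₂ g w y β a γ = -∑ l, riemannUp g y l γ a β * w y l := by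
  have hcomm := pd_comm a β hg.isOpen hy (hw γ)
  simp only [covDeriv₂, hg.pd_covDeriv hw hy, hg.christoffel_symm _ β a]
  rw [hcomm]
  simp only [covDeriv, riemannUp, Fin.sum_univ_four]
  ring

omit hw in
theorem covDeriv₂_antisymm (hy : y ∈ U)
    (hC : ∀ z ∈ U, ∀ α β, covDeriv g w z α β = -covDeriv g w z β α) (a β γ : Fin 4) :
    covDeriv₂ g w y a β γ = -covDeriv₂ g w y a γ β := by
  have h := pd_congr a hg.isOpen hy fun z hz => hC z hz β γ
  rw [pd_neg] at h
  simp only [covDeriv₂, h, hC y hy _ γ, mul_neg, Finset.sum_neg_distrib, hC y hy β]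
  ring

/-- The covariant derivative of `w ∧ C = 0`, where `C = ∇w`: `∇_a w ∧ C + w ∧ ∇_a C = 0`. -/
theorem wedge_covDeriv₂ (hy : y ∈ U)
    (hW : ∀ z ∈ U, ∀ α β γ, wedge₁₂ (w z) (covDeriv g w z) α β γ = 0) (a α β γ : Fin 4) :
    wedge₁₂ (covDeriv g w y a) (covDeriv g w y) α β γ
      + wedge₁₂ (w y) (covDeriv₂ g w y a) α β γ = 0 := by
  have hd := fun l => differentiableAt_of_contDiffOn hg.isOpen hy (hw l)
  have hc := fun i j => differentiableAt_of_contDiffOn hg.isOpen hy (hg.contDiffOn_covDeriv hw i j)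
  have h : pd a (fun z => wedge₁₂ (w z) (covDeriv g w z) α β γ) y = pd a (fun _ => 0) y :=
    pd_congr a hg.isOpen hy fun z hz => hW z hz α β γ
  have h0 : pd a (fun _ => 0) y = 0 := by simp [pd]
  simp only [wedge₁₂] at h
  rw [h0, pd_add a (((hd _).fun_mul (hc _ _)).fun_add ((hd _).fun_mul (hc _ _)))
    ((hd _).fun_mul (hc _ _)), pd_add a ((hd _).fun_mul (hc _ _)) ((hd _).fun_mul (hc _ _)),
    pd_mul a (hd _) (hc _ _), pd_mul a (hd _) (hc _ _), pd_mul a (hd _) (hc _ _)] at h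
  -- the Christoffel symbols act on `w ∧ C` as a derivation, so their total contribution vanishes
  have e : ∀ i j k, ∑ l, christoffel g l a i y * wedge₁₂ (w y) (covDeriv g w y) l j k = 0 :=
    fun i j k => Finset.sum_eq_zero fun l _ => by rw [hW y hy, mul_zero]
  have e1 := e α β γ
  have e2 := e β γ α
  have e3 := e γ α β
  have p : ∀ i, covDeriv g w y a i
    = pd a (fun z => w z i) y - ∑ l, christoffel g l a i y * w y l := fun i => rfl
  simp only [wedge₁₂, covDeriv₂, p, Fin.sum_univ_four] at e1 e2 e3 h ⊢
  linear_combination h - e1 - e2 - e3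

/-- The Killing identity `∇_a ∇_β w_γ = -R_{βγaδ} x^δ`, for `w_i = g_{ij} x^j` with
antisymmetric `∇w`; it follows from the Ricci identity and the first Bianchi identity. -/
theorem covDeriv₂_killing {x : Fin 4 → ℝ} (hy : y ∈ U) (hx : ∀ i, w y i = ∑ j, g y i j * x j)
    (hC : ∀ z ∈ U, ∀ α β, covDeriv g w z α β = -covDeriv g w z β α) (a β γ : Fin 4) :
    covDeriv₂ g w y a β γ = -∑ δ, riemann g y β γ a δ * x δ := by
  have K : ∀ γ a β, ∑ l, riemannUp g y l γ a β * w y l = ∑ j, riemann g y j γ a β * x j := by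
    intro γ a β
    simp only [hx, riemann, Finset.sum_mul, Finset.mul_sum]
    rw [Finset.sum_comm]
    exact Finset.sum_congr rfl fun i _ => Finset.sum_congr rfl fun j _ => by
      rw [hg.symm y i j]; ring
  have r : ∀ a β γ, covDeriv₂ g w y a β γ - covDeriv₂ g w y β a γ
      = -∑ j, riemann g y j γ a β * x j := fun a β γ => by
    rw [hg.covDeriv₂_sub hw hy, K]
  have s := hg.covDeriv₂_antisymm hy hC
  have cyc : ∑ j, riemann g y j a β γ * x j + ∑ j, riemann g y j β γ a * x j
      + ∑ j, riemann g y j γ a β * x j = 0 := by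
    simp only [← Finset.sum_add_distrib, ← add_mul]
    exact Finset.sum_eq_zero fun j _ => by rw [hg.riemann_cyclic, zero_mul]
  have e : ∑ δ, riemann g y β γ a δ * x δ = -∑ j, riemann g y j a β γ * x j := by
    rw [← Finset.sum_neg_distrib]
    exact Finset.sum_congr rfl fun j _ => by
      rw [hg.riemann_pair_symm hy β γ a j, hg.riemann_antisymm_fst hy a j]; ring
  linarith [r a β γ, r β γ a, r γ a β, s a β γ, s β γ a, s γ a β]

/-- Where a hypersurface-orthogonal Killing 1-form `w` does not vanish, the 2-forms
`R_{βγαδ} x^δ` are divisible by `w`. -/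
theorem exists_riemann_contract_eq {x : Fin 4 → ℝ} (hy : y ∈ U) (hw0 : w y ≠ 0)
    (hx : ∀ i, w y i = ∑ j, g y i j * x j)
    (hK : ∀ z ∈ U, ∀ α β, covDeriv g w z α β + covDeriv g w z β α = 0)
    (hO : ∀ z ∈ U, ∀ α β γ, wedge₁₂ (w z) (extD w z) α β γ = 0) :
    ∃ A : Fin 4 → Fin 4 → ℝ, ∀ β γ α,
      ∑ δ, riemann g y β γ α δ * x δ = w y β * A α γ - w y γ * A α β := by
  have hC : ∀ z ∈ U, ∀ α β, covDeriv g w z α β = -covDeriv g w z β α := fun z hz α β =>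
    eq_neg_of_add_eq_zero_left (hK z hz α β)
  have hE : ∀ z ∈ U, ∀ α β, extD w z α β = 2 * covDeriv g w z α β := by
    intro z hz α β
    have h1 : extD w z α β = covDeriv g w z α β - covDeriv g w z β α := by
      simp only [extD, covDeriv, hg.christoffel_symm _ β α]; ring
    rw [h1, hC z hz β α]; ring
  have hW : ∀ z ∈ U, ∀ α β γ, wedge₁₂ (w z) (covDeriv g w z) α β γ = 0 := by
    intro z hz α β γ
    have := hO z hz α β γ
    simp only [wedge₁₂, hE z hz] at this ⊢
    linarith
  obtain ⟨θ, hθ⟩ := exists_wedge_factor hw0 (hC y hy) (hW y hy)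
  -- `∇_a w ∧ ∇w = 0`, as `∇w = w ∧ θ` and `∇_a w` is a combination of `w` and `θ`
  have hD : ∀ a α β γ, wedge₁₂ (w y) (covDeriv₂ g w y a) α β γ = 0 := by
    intro a α β γ
    have h := hg.wedge_covDeriv₂ hw hy hW a α β γ
    have h0 : wedge₁₂ (covDeriv g w y a) (covDeriv g w y) α β γ = 0 := by
      simp only [wedge₁₂, hθ]; ring
    linarith
  choose B hB using fun a => exists_wedge_factor hw0 (hg.covDeriv₂_antisymm hy hC a) (hD a)
  refine ⟨fun α γ => -B α γ, fun β γ α => ?_⟩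
  have h1 := hg.covDeriv₂_killing hw hy hx hC α β γ
  have h2 := hB α β γ
  linarith

end IsSmoothMetricOn

theorem IsSmoothMetricOn.apply_eq_sum_ginv_mul_lower {g : R4 → Matrix (Fin 4) (Fin 4) ℝ}
    {U : Set R4} {y : R4} (hg : IsSmoothMetricOn g U) (hy : y ∈ U) (v : R4 → Fin 4 → ℝ)
    (i : Fin 4) : v y i = ∑ j, ginv g y i j * lower g v y j := by
  have : Matrix.mulVec (ginv g y) (Matrix.mulVec (g y) (v y)) = v y := by
    rw [Matrix.mulVec_mulVec, hg.ginv_mul hy, Matrix.one_mulVec]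
  exact (congrFun this i).symm

/-- The coordinate form of the result: the Bel current of a hypersurface-orthogonal Killing field is
a multiple of its 1-form. -/
theorem IsSmoothMetricOn.exists_current_eq {g : R4 → Matrix (Fin 4) (Fin 4) ℝ} {U : Set R4}
    {v : R4 → Fin 4 → ℝ} {y : R4} (hg : IsSmoothMetricOn g U)
    (hw : ∀ i, ContDiffOn ℝ ∞ (fun z => lower g v z i) U) (hy : y ∈ U)
    (hK : ∀ z ∈ U, ∀ α β, covDeriv g (lower g v) z α β + covDeriv g (lower g v) z β α = 0)
    (hO : ∀ z ∈ U, ∀ α β γ, wedge₁₂ (lower g v z) (extD (lower g v) z) α β γ = 0) :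
    ∃ c : ℝ, ∀ μ, current g v v v y μ = c * lower g v y μ := by
  set w := lower g v
  have hx : ∀ i, v y i = ∑ j, ginv g y i j * w y j := hg.apply_eq_sum_ginv_mul_lower hy v
  -- where `w` vanishes so does `v`, hence the current; only elsewhere can one divide by `w`
  by_cases hw0 : w y = 0
  · have hv : ∀ i, v y i = 0 := fun i => by rw [hx]; simp [hw0]
    exact ⟨0, fun μ => by simp [current, hv]⟩
  obtain ⟨A, hA⟩ := hg.exists_riemann_contract_eq hw hy hw0 (fun i => rfl) hK hO
  have R12 := hg.riemann_antisymm_fst hy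
  have R34 := riemann_antisymm_snd (g := g) y
  have Rp := hg.riemann_pair_symm hy
  have hsym := hg.ginv_symm y
  exact exists_current_eq_smul hw0 (hg.symm y) hsym hx R12 R34 Rp hA

end Spacetime.Coord

namespace Spacetime

/-! ### Components of tensor fields in a chart -/

section
variable {M : Type*} [TopologicalSpace M] [ChartedSpace R4 M] [IsManifold (𝓡 4) ∞ M]
  {e : OpenPartialHomeomorph M R4} (he : e ∈ IsManifold.maximalAtlas (𝓡 4) ∞ M)
include he

omit [IsManifold (𝓡 4) ∞ M] in
theorem mdifferentiable_of_mem_maximalAtlas : e.MDifferentiable (𝓡 4) (𝓡 4) :=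
  ⟨(contMDiffOn_of_mem_maximalAtlas he).mdifferentiableOn (by simp),
    (contMDiffOn_symm_of_mem_maximalAtlas he).mdifferentiableOn (by simp)⟩

theorem contMDiffOn_coordVector (i : Fin 4) :
    ContMDiffOn (𝓡 4) (𝓡 4).tangent ∞
      (fun y => (⟨e.symm y, coordVector e y i⟩ : TangentBundle (𝓡 4) M)) e.target := by
  have h1 := (contMDiffOn_symm_of_mem_maximalAtlas he).contMDiffOn_tangentMapWithin (m := ∞)
    (by simp) e.open_target.uniqueMDiffOn
  have h2 : ContMDiffOn (𝓡 4) (𝓡 4).tangent ∞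
      (fun y : R4 => (⟨y, (EuclideanSpace.single i (1 : ℝ) : R4)⟩ : TangentBundle (𝓡 4) R4))
      e.target :=
    contMDiffOn_vectorSpace_iff_contDiffOn.2 contDiffOn_const
  refine (h1.comp h2 fun y hy => hy).congr fun y hy => ?_
  simp only [tangentMapWithin, Function.comp, coordVector,
    mfderivWithin_of_isOpen e.open_target hy]

/-- The scalar product of two vector fields which are smooth on a chart domain is smooth in the
coordinates. -/
theorem contDiffOn_metric_apply (g : LorentzMetric M)
    {v w : (y : R4) → TangentSpace (𝓡 4) (e.symm y)}
    (hv : ContMDiffOn (𝓡 4) (𝓡 4).tangent ∞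
      (fun y => (⟨e.symm y, v y⟩ : TangentBundle (𝓡 4) M)) e.target)
    (hw : ContMDiffOn (𝓡 4) (𝓡 4).tangent ∞
      (fun y => (⟨e.symm y, w y⟩ : TangentBundle (𝓡 4) M)) e.target) :
    ContDiffOn ℝ ∞ (fun y => g.val (e.symm y) (v y) (w y)) e.target := by
  have hg := g.contMDiff.comp_contMDiffOn (contMDiffOn_symm_of_mem_maximalAtlas he)
  have h := ContMDiffOn.clm_bundle_apply₂ (F₁ := R4) (F₂ := R4) (F₃ := ℝ)
    (E₁ := fun p : M => TangentSpace (𝓡 4) p) (E₂ := fun p : M => TangentSpace (𝓡 4) p)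
    (E₃ := Bundle.Trivial M ℝ) (ψ := fun y => g.val (e.symm y)) hg hv hw
  intro y hy
  have := (Bundle.contMDiffWithinAt_totalSpace.1 (h y hy)).2
  exact contMDiffWithinAt_iff_contDiffWithinAt.1 this

omit he [IsManifold (𝓡 4) ∞ M] in
/-- The differential of the inverse chart maps `u` to `u^i ∂/∂x^i`. -/
theorem sum_smul_coordVector (e : OpenPartialHomeomorph M R4) (y u : R4) :
    ∑ i, u i • coordVector e y i = mfderiv (𝓡 4) (𝓡 4) e.symm y u := by
  have hsum : u = ∑ i, u i • (EuclideanSpace.single i (1 : ℝ) : R4) := by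
    ext j; simp [Finset.sum_apply, Pi.single_apply]
  let L : R4 →L[ℝ] TangentSpace (𝓡 4) (e.symm y) := mfderiv (𝓡 4) (𝓡 4) e.symm y
  change ∑ i, u i • L (EuclideanSpace.single i (1 : ℝ)) = L u
  conv_rhs => rw [hsum, map_sum]
  exact Finset.sum_congr rfl fun i _ => (map_smul L _ _).symm

omit [IsManifold (𝓡 4) ∞ M] in
/-- The components `ξ^i` represent the vector field: `ξ = ξ^i ∂/∂x^i`. -/
theorem sum_vecInChart_smul_coordVector (ξ : (p : M) → TangentSpace (𝓡 4) p) {y : R4}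
    (hy : y ∈ e.target) : ∑ i, vecInChart ξ e y i • coordVector e y i = ξ (e.symm y) := by
  have hd := mdifferentiable_of_mem_maximalAtlas he
  have h := hd.symm_comp_deriv (e.map_target hy)
  rw [e.right_inv hy] at h
  exact (sum_smul_coordVector e y _).trans (congrArg (fun L => L (ξ (e.symm y))) h)

/-- The covariant components are `ξ_i = g(∂/∂x^i, ξ)`; this gives their smoothness without that of
the components `ξ^i`. -/
theorem formInChart_eq (g : LorentzMetric M) (ξ : (p : M) → TangentSpace (𝓡 4) p) {y : R4}
    (hy : y ∈ e.target) (i : Fin 4) :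
    formInChart g ξ e y i = g.val (e.symm y) (coordVector e y i) (ξ (e.symm y)) := by
  rw [← sum_vecInChart_smul_coordVector he ξ hy,
    map_sum (g.val (e.symm y) (coordVector e y i))]
  change ∑ j, g.inChart e y i j * vecInChart ξ e y j = _
  refine Finset.sum_congr rfl fun j _ => ?_
  rw [map_smul, smul_eq_mul, mul_comm]; rfl

theorem contDiffOn_formInChart (g : LorentzMetric M) {ξ : (p : M) → TangentSpace (𝓡 4) p}
    (hξ : SmoothVectorField ξ) (i : Fin 4) :
    ContDiffOn ℝ ∞ (fun y => formInChart g ξ e y i) e.target :=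
  (contDiffOn_metric_apply he g (contMDiffOn_coordVector he i)
    (ContMDiff.comp_contMDiffOn hξ (contMDiffOn_symm_of_mem_maximalAtlas he))).congr
    fun _ hy => formInChart_eq he g ξ hy i

omit he in
theorem LorentzMetric.nondegenerate (g : LorentzMetric M) (p : M) {v : TangentSpace (𝓡 4) p}
    (h : ∀ u, g.val p u v = 0) : v = 0 := by
  obtain ⟨b, hb⟩ := g.lorentzian p
  have hv := b.sum_repr v
  have : ∀ i, b.repr v i = 0 := by
    intro i
    have h1 := h (b i)
    rw [← hv, map_sum] at h1
    simp only [map_smul, hb, smul_eq_mul, mul_ite, mul_zero, Finset.sum_ite_eq,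
      Finset.mem_univ, if_true] at h1
    split_ifs at h1 <;> simpa using h1
  rw [← hv]; simp [this]

theorem det_inChart_ne_zero (g : LorentzMetric M) {y : R4} (hy : y ∈ e.target) :
    (g.inChart e y).det ≠ 0 := by
  intro h0
  obtain ⟨v, hv, hv0⟩ := Matrix.exists_mulVec_eq_zero_iff.2 h0
  let L : R4 →L[ℝ] TangentSpace (𝓡 4) (e.symm y) := mfderiv (𝓡 4) (𝓡 4) e.symm y
  have hL : Function.Bijective L :=
    (mdifferentiable_of_mem_maximalAtlas he).symm.mfderiv_bijective hy
  have hsum : ∀ u : R4, L u = ∑ i, u i • coordVector e y i := fun u =>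
    (sum_smul_coordVector e y u).symm
  have hz : L (WithLp.toLp 2 v) = 0 := by
    refine g.nondegenerate _ fun u => ?_
    obtain ⟨u, rfl⟩ := hL.2 u
    have h1 : ∀ i, g.val (e.symm y) (coordVector e y i) (L (WithLp.toLp 2 v)) = 0 := by
      intro i
      have := congrFun hv0 i
      simp only [Matrix.mulVec, dotProduct, LorentzMetric.inChart, Matrix.of_apply,
        Pi.zero_apply] at this
      rw [hsum, map_sum, ← this]
      exact Finset.sum_congr rfl fun j _ => by rw [map_smul, smul_eq_mul, mul_comm]
    rw [g.symm, hsum u, map_sum]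
    exact Finset.sum_eq_zero fun i _ => by rw [map_smul, g.symm, h1, smul_zero]
  have : WithLp.toLp 2 v = (0 : R4) := hL.1 (hz.trans (map_zero L).symm)
  exact hv (by simpa using congrArg WithLp.ofLp this)

theorem isSmoothMetricOn_inChart (g : LorentzMetric M) :
    Coord.IsSmoothMetricOn (g.inChart e) e.target where
  isOpen := e.open_target
  symm _ _ _ := g.symm _ _ _
  contDiffOn i j := contDiffOn_metric_apply he g (contMDiffOn_coordVector he i)
    (contMDiffOn_coordVector he j)
  det_ne_zero _ hy := det_inChart_ne_zero he g hy

end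
end Spacetime

theorem mainTheorem2 {M : Type*} [TopologicalSpace M] [ChartedSpace Spacetime.R4 M]
    [IsManifold (𝓡 4) ∞ M] (g : Spacetime.LorentzMetric M) (ξ : (p : M) → TangentSpace (𝓡 4) p)
    (hK : Spacetime.IsKilling g ξ) (hO : Spacetime.IsHypersurfaceOrthogonal g ξ) :
    ∀ e ∈ IsManifold.maximalAtlas (𝓡 4) ∞ M, ∀ y ∈ e.target,
      (∀ μ γ, Spacetime.Coord.wedge₁₁ (Spacetime.belCurrent g ξ e y)
        (Spacetime.formInChart g ξ e y) μ γ = 0) ∧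
      ∃ a : ℝ, ∀ μ, Spacetime.Coord.raise (g.inChart e) (Spacetime.belCurrent g ξ e) y μ
        = a * Spacetime.vecInChart ξ e y μ := by
  intro e he y hy
  have hg := Spacetime.isSmoothMetricOn_inChart he g
  obtain ⟨c, hc⟩ := hg.exists_current_eq (Spacetime.contDiffOn_formInChart he g hK.1) hy
    (hK.2 e he) (hO e he)
  have hj : ∀ μ, Spacetime.belCurrent g ξ e y μ = c * Spacetime.formInChart g ξ e y μ := hc
  refine ⟨fun μ γ => ?_, c, fun μ => ?_⟩
  · simp only [Spacetime.Coord.wedge₁₁, hj]; ring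
  · rw [hg.apply_eq_sum_ginv_mul_lower hy (Spacetime.vecInChart ξ e)]
    simp only [Spacetime.Coord.raise, hj, Finset.mul_sum]
    exact Finset.sum_congr rfl fun _ _ => by rw [mul_left_comm]; rfl
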